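/- A ribbon graph $G=(V,E)$ is a surface with boundary that is the union of a finite set $V$ of vertex discs and a finite set $E$ of edge discs, such that the vertices and edges intersect in disjoint line segments, each segment lies on the boundary of exactly one vertex and exactly one edge, and each edge contains exactly two segments; ribbon graphs are considered up to homeomorphisms preserving this structure. (Ribbon graphs may be disconnected, non-orientable, and have loops, multiple edges and isolated vertices.) A ribbon subgraph of $G$ is a ribbon graph obtained from $G$ by removing vertices and edges, the edges at a removed vertex being removed as well. Write $k(H)$ for the number of connected components and $f(H)$ for the number of boundary components of a ribbon graph $H$, and for $A\subseteq E$ let $f(A)=f(V,A)$, where $(V,A)$ is the spanning ribbon subgraph with edge set $A$. The subgraph $(V,A)$ is a spanning quasi-tree of $G$ if $k(V,A)=k(G)$ and each connected component of $(V,A)$ has exactly one boundary component. A set system $(E,\mathcal F)$ is a set $E$ with a collection $\mathcal F$ of subsets of $E$. Let $D(G)=(E,\mathcal F(G))$, where $\mathcal F(G)$ is the collection of edge sets of spanning quasi-trees of $G$, and for an integer $n\ge 0$ let $$D_{\le n}(G)=\bigl(E,\{A\subseteq E\mid f(A)\le k(G)+n\}\bigr),\qquad D_{n}(G)=\bigl(E,\{A\subseteq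 E\mid f(A)= k(G)+n\}\bigr).$$ For a set system $D=(E,\mathcal F)$ and an integer $n$, let $\mathcal F_{\le n}=\{F\bigtriangleup A\mid F\in\mathcal F,\ A\subseteq E,\ |A|\le n\}$ (so $\mathcal F_{\le -1}=\emptyset$). For $n\ge 0$ the $n$-spread of $D$ is $(E,\mathcal F_{\le n})$, and, provided that $\mathcal F_{\bigtriangleup n}:=\mathcal F_{\le n}\setminus\mathcal F_{\le n-1}$ is non-empty, the $n$-toggle of $D$ is $(E,\mathcal F_{\bigtriangleup n})$. **Theorem.** Let $G=(V,E)$ be a ribbon graph and $n\geq 0$ an integer. Then 1. $D_{\le n}(G)$ is the $n$-spread of $D(G)$; 2. if $G$ has a ribbon subgraph (spanning or not) with $n+k(G)$ boundary components, then the $n$-toggle of $D(G)$ is defined, that is, $\mathcal F(G)_{\bigtriangleup n}\neq\emptyset$, and $D_n(G)$ is equal to it. -/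

import Mathlib

open scoped symmDiff

/-! ### Set systems, spreads and toggles -/

/-- A set system with ground set `E`: a collection of feasible subsets of `E`. -/
@[ext] structure SetSystem (E : Type*) where
  feasible : Set (Set E)

namespace SetSystem

variable {E : Type*}

/-- The `n`-spread: feasible sets are `F ∆ A` with `F` feasible and `|A| ≤ n`.
The index is an integer, so that the spread of index `-1` has no feasible sets. -/
def spread (D : SetSystem E) (n : ℤ) : SetSystem E where
  feasible := {X | ∃ F ∈ D.feasible, ∃ A : Set E, (A.ncard : ℤ) ≤ n ∧ X = F ∆ A}

/-- The `n`-toggle: the feasible sets of the `n`-spread that are not feasible in the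
`(n - 1)`-spread. -/
def toggle (D : SetSystem E) (n : ℤ) : SetSystem E where
  feasible := (D.spread n).feasible \ (D.spread (n - 1)).feasible

end SetSystem

/-! ### Ribbon graphs -/

/-- A ribbon graph with vertex discs `V` and edge discs `E`, given by a signed rotation system
after choosing an orientation of every vertex disc.

The pair `(e, i) : E × Bool` is one of the two line segments (half-edges) in which the edge disc
`e` meets the vertex discs; `vert (e, i)` is the vertex disc on whose boundary it lies. Going
around the boundary of a vertex disc in its chosen direction, the segment met after `h` is
`rot h`; thus the segments on one vertex disc form exactly one cycle of `rot`. The edge disc `e`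
respects the chosen orientations of the discs at its ends if `twisted e = false`, and reverses
them if `twisted e = true`. Loops, multiple edges, isolated vertices, several connected
components and non-orientable ribbon graphs are all allowed. -/
structure RibbonGraph (V E : Type*) where
  vert : E × Bool → V
  rot : Equiv.Perm (E × Bool)
  twisted : E → Bool
  vert_eq_iff : ∀ h h', vert h = vert h' ↔ rot.SameCycle h h'

namespace RibbonGraph

variable {V E : Type*}

/-- A ribbon subgraph: what remains after removing vertices and edges, where the edges at a
removed vertex are removed too. -/
structure Subgraph (G : RibbonGraph V E) where
  verts : Set V
  edges : Set E
  vert_mem : ∀ e ∈ edges, ∀ i, G.vert (e, i) ∈ verts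

/-- The spanning ribbon subgraph `(V, A)`. -/
def spanning (G : RibbonGraph V E) (A : Set E) : G.Subgraph where
  verts := Set.univ
  edges := A
  vert_mem := fun _ _ _ => Set.mem_univ _

namespace Subgraph

variable {G : RibbonGraph V E}

/-- The connected components of a ribbon subgraph: classes of its vertices under the equivalence
relation generated by adjacency through its edges. -/
def Component (H : G.Subgraph) : Type _ :=
  Quot (fun u v : H.verts => ∃ e ∈ H.edges, ∃ i, G.vert (e, i) = u ∧ G.vert (e, !i) = v)

/-- The number of connected components. -/
noncomputable def k (H : G.Subgraph) : ℕ := Nat.card H.Component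

/-- One step along the boundary of the surface `H`.

The corners of the edge discs of `G` are the ends of the line segments: `(h, false)` and
`(h, true)` are the first and the last point of the segment `h`, in the chosen direction of the
vertex disc on which `h` lies. They cut the boundary of `H` into the following pieces, and
each piece joins two corners. -/
inductive BoundaryStep (H : G.Subgraph) : (E × Bool) × Bool → (E × Bool) × Bool → Prop
  /-- The arc of the boundary of a vertex disc from the end of a segment to the start of the
  next one. -/
  | arc (h : E × Bool) : BoundaryStep H (h, true) (G.rot h, false)
  /-- If the edge is not in `H`, its segments are part of the boundary. -/
  | segment (h : E × Bool) (he : h.1 ∉ H.edges) : BoundaryStep H (h, false) (h, true)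
  /-- If the edge is in `H`, its two sides are part of the boundary. A side of an untwisted edge
  joins the last point of one of the two segments to the first point of the other; a side of a
  twisted edge joins the first points or the last points. -/
  | side (e : E) (i s : Bool) (he : e ∈ H.edges) :
      BoundaryStep H ((e, i), s) ((e, !i), if G.twisted e then s else !s)

/-- The corners that lie on vertex discs of `H`. -/
def Corner (H : G.Subgraph) : Type _ :=
  {c : (E × Bool) × Bool // G.vert c.1 ∈ H.verts}

/-- The number of boundary components: closed curves through the corners on the vertex discs of
`H`, and the boundary circles of the vertex discs of `H` that carry no corner at all because
the vertex is isolated in `G`. -/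
noncomputable def f (H : G.Subgraph) : ℕ :=
  Nat.card (Quot (fun c d : H.Corner => H.BoundaryStep c.1 d.1)) +
    Nat.card {v : V // v ∈ H.verts ∧ ∀ h, G.vert h ≠ v}

/-- A connected component, as a ribbon subgraph. -/
def component (H : G.Subgraph) (C : H.Component) : G.Subgraph where
  verts := {v | ∃ hv : v ∈ H.verts, (Quot.mk _ ⟨v, hv⟩ : H.Component) = C}
  edges := {e | ∃ he : e ∈ H.edges,
    (Quot.mk _ ⟨G.vert (e, false), H.vert_mem e he false⟩ : H.Component) = C}
  vert_mem := by
    rintro e ⟨he, hC⟩ i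
    refine ⟨H.vert_mem e he i, ?_⟩
    cases i
    · exact hC
    · exact Eq.trans (Quot.sound ⟨e, he, true, rfl, rfl⟩) hC

end Subgraph

/-- The number of connected components of `G`. -/
noncomputable def k (G : RibbonGraph V E) : ℕ := (G.spanning Set.univ).k

/-- `A` is the edge set of a spanning quasi-tree of `G`: the spanning ribbon subgraph `(V, A)`
has as many connected components as `G`, and each of them has exactly one boundary component. -/
def IsSpanningQuasiTree (G : RibbonGraph V E) (A : Set E) : Prop :=
  (G.spanning A).k = G.k ∧
    ∀ C : (G.spanning A).Component, ((G.spanning A).component C).f = 1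

/-- The delta-matroid `D(G)`: feasible sets are the edge sets of the spanning quasi-trees. -/
def D (G : RibbonGraph V E) : SetSystem E where
  feasible := {A | G.IsSpanningQuasiTree A}

/-- `D_{≤ n}(G)`: feasible sets are the `A ⊆ E` with `f(A) ≤ k(G) + n`. -/
def DLe (G : RibbonGraph V E) (n : ℕ) : SetSystem E where
  feasible := {A | (G.spanning A).f ≤ G.k + n}

/-- `D_n(G)`: feasible sets are the `A ⊆ E` with `f(A) = k(G) + n`. -/
def DEq (G : RibbonGraph V E) (n : ℕ) : SetSystem E where
  feasible := {A | (G.spanning A).f = G.k + n}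

end RibbonGraph

/-! Write `f A` for the number of boundary components of `(V, A)`. Toggling one edge `e` replaces
two of the pieces of the boundary between corners of `e` by two others on the same four corners, so
it changes `f` by at most one. If these two pieces lie on different boundary curves, toggling `e`
merges the curves; hence, if no toggle lowers `f`, all corners of an edge lie on one boundary curve.
Neighbouring corners on a vertex disc lie on one curve as well, so there is then exactly one
boundary component for every connected component of `G`. Since `f A ≥ k(G)`, with equality exactly
for spanning quasi-trees, `f A - k(G)` is the distance from `A` to the nearest spanning quasi-tree,
and this determines the spreads and toggles of `D(G)`.

A ribbon subgraph `H` is a union of components of the spanning one with the same edges, so it has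
at most as many boundary components; as `f` descends in steps of one, it takes every value from
`k(G)` up to that number. -/

section Quotients

variable {α β : Type*}

theorem card_quot_le_card_quot_add_one {r r' : α → α → Prop} [Finite (Quot r')] (a c : α)
    (h : ∀ x y, r' x y → Quot.mk r x = Quot.mk r y ∨
      (Quot.mk r x = Quot.mk r a ∨ Quot.mk r x = Quot.mk r c) ∧
      (Quot.mk r y = Quot.mk r a ∨ Quot.mk r y = Quot.mk r c)) :
    Nat.card (Quot r) ≤ Nat.card (Quot r') + 1 := by
  classical
  let merge : Quot r → Quot r := Function.update id (Quot.mk r c) (Quot.mk r a)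
  have merge_left : merge (Quot.mk r a) = Quot.mk r a := by
    simp only [merge, Function.update_apply, id, ite_self]
  have merge_right : merge (Quot.mk r c) = Quot.mk r a := Function.update_self ..
  let φ : Quot r' → Quot r := Quot.lift (fun x => merge (Quot.mk r x)) fun x y hxy => by
    rcases h x y hxy with hxy | ⟨hx | hx, hy | hy⟩ <;> simp only [*]
  have hφ : (Set.univ : Set (Quot r)) ⊆ insert (Quot.mk r c) (Set.range φ) := by
    rintro ⟨x⟩ -
    by_cases hx : Quot.mk r x = Quot.mk r c
    · exact .inl hx
    · exact .inr ⟨Quot.mk r' x, Function.update_of_ne hx ..⟩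
  calc Nat.card (Quot r) = (Set.univ : Set (Quot r)).ncard := (Set.ncard_univ _).symm
    _ ≤ (insert (Quot.mk r c) (Set.range φ)).ncard := Set.ncard_le_ncard hφ (Set.toFinite _)
    _ ≤ (Set.range φ).ncard + 1 := Set.ncard_insert_le _ _
    _ ≤ Nat.card (Quot r') + 1 := Nat.add_le_add_right (Finite.card_range_le φ) 1

theorem card_quot_lt_card_quot {r r' : α → α → Prop} [Finite (Quot r)] {a c : α}
    (h : ∀ x y, r x y → Quot.mk r' x = Quot.mk r' y)
    (hne : Quot.mk r a ≠ Quot.mk r c) (heq : Quot.mk r' a = Quot.mk r' c) :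
    Nat.card (Quot r') < Nat.card (Quot r) := by
  let φ : Quot r → Quot r' := Quot.lift (Quot.mk r') h
  have hφ : Function.Surjective φ := by
    rintro ⟨x⟩
    exact ⟨Quot.mk r x, rfl⟩
  refine (Nat.card_le_card_of_surjective φ hφ).lt_of_ne fun hcard => hne ?_
  exact ((Nat.bijective_iff_surjective_and_card φ).2 ⟨hφ, hcard.symm⟩).1 heq

theorem injective_quot_map {r : α → α → Prop} {s : β → β → Prop} {f : α → β}
    (hf : Function.Injective f) (hrs : ∀ x y, r x y ↔ s (f x) (f y))
    (hs : ∀ x y, s x y → (x ∈ Set.range f ↔ y ∈ Set.range f)) :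
    Function.Injective (Quot.map f fun x y => (hrs x y).1) := by
  let retract : β → Option (Quot r) := Function.extend f (some ∘ Quot.mk r) fun _ => none
  have retract_of_notMem : ∀ x ∉ Set.range f, retract x = none := fun x hx =>
    Function.extend_apply' _ _ x hx
  have retract_eq : ∀ x y, s x y → retract x = retract y := by
    intro x y hxy
    by_cases hx : x ∈ Set.range f
    · obtain ⟨y', rfl⟩ := (hs x y hxy).1 hx
      obtain ⟨x', rfl⟩ := hx
      simp only [retract, hf.extend_apply, Function.comp_apply]
      exact congrArg some (Quot.sound ((hrs x' y').2 hxy))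
    · rw [retract_of_notMem x hx, retract_of_notMem y (mt (hs x y hxy).2 hx)]
  have retract_map : ∀ q, Quot.lift retract retract_eq (Quot.map f (fun x y => (hrs x y).1) q) =
      some q := by
    rintro ⟨x⟩
    exact hf.extend_apply ..
  exact fun q q' h => Option.some_injective _ (by rw [← retract_map q, ← retract_map q', h])

end Quotients

section Permutations

variable {α β : Type*}

theorem even_card_of_involutive {s : Finset α} {σ : α → α} (hσ : Function.Involutive σ)
    (hfix : ∀ x, σ x ≠ x) (hs : ∀ x ∈ s, σ x ∈ s) : Even s.card := by
  have h : ∑ _x ∈ s, (1 : ZMod 2) = 0 :=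
    Finset.sum_involution (fun x _ => σ x) (fun _ _ => by decide) (fun x _ _ => hfix x)
      hs (fun x _ => hσ x)
  rw [Finset.sum_const, nsmul_eq_mul, mul_one] at h
  exact ZMod.natCast_eq_zero_iff_even.1 h

theorem apply_mem_of_involutive {s : Set α} (hs : s.Finite) {σ τ : α → α}
    (hσ : Function.Involutive σ) (hσfix : ∀ x, σ x ≠ x)
    (hτ : Function.Involutive τ) (hτfix : ∀ x, τ x ≠ x) {a : α} (ha : a ∈ s)
    (hσs : ∀ x ∈ s, σ x ∈ s) (hτs : ∀ x ∈ s, x ≠ a → τ x ∈ s) : τ a ∈ s := by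
  classical
  lift s to Finset α using hs
  simp only [Finset.mem_coe] at *
  by_contra hτa
  have heven : Even s.card := even_card_of_involutive hσ hσfix hσs
  have heven_erase : Even (s.erase a).card :=
    even_card_of_involutive hτ hτfix fun x hx => by
      obtain ⟨hxa, hxs⟩ := Finset.mem_erase.1 hx
      refine Finset.mem_erase.2 ⟨?_, hτs x hxs hxa⟩
      rintro rfl
      exact hτa (by rwa [hτ])
  rw [← Finset.card_erase_add_one ha] at heven
  exact Nat.even_add_one.1 heven heven_erase

theorem apply_eq_of_sameCycle {σ : Equiv.Perm α} {φ : α → β} (hφ : ∀ x, φ (σ x) = φ x)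
    {x y : α} (h : σ.SameCycle x y) : φ x = φ y := by
  obtain ⟨n, rfl⟩ := h
  induction n with
  | zero => rfl
  | succ n ih => rw [ih, add_comm, zpow_one_add, Equiv.Perm.mul_apply, hφ]
  | pred n ih =>
    rw [ih, ← hφ ((σ ^ (-(n : ℤ) - 1)) x), ← Equiv.Perm.mul_apply, ← zpow_one_add,
      add_sub_cancel]

end Permutations

namespace SetSystem

variable {E : Type*} {D : SetSystem E} {φ : Set E → ℕ} {m : ℕ}

/-- `φ` is minimal, with value `m`, exactly at the feasible sets of `D`; it grows by at most one
when a single element is toggled, and some toggle lowers it wherever it is above `m`. Such a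
function exceeds `m` by the distance to the nearest feasible set. -/
structure IsLevelFunction (D : SetSystem E) (φ : Set E → ℕ) (m : ℕ) : Prop where
  mem_feasible_iff : ∀ A, A ∈ D.feasible ↔ φ A = m
  le_apply : ∀ A, m ≤ φ A
  apply_symmDiff_singleton_le : ∀ A e, φ (A ∆ {e}) ≤ φ A + 1
  exists_apply_symmDiff_lt : ∀ A, m < φ A → ∃ e, φ (A ∆ {e}) < φ A

namespace IsLevelFunction

theorem apply_symmDiff_le [Finite E] (h : D.IsLevelFunction φ m) (A X : Set E) :
    φ (A ∆ X) ≤ φ A + X.ncard := by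
  induction X, X.toFinite using Set.Finite.induction_on with
  | empty => simp only [← Set.bot_eq_empty, symmDiff_bot, Nat.le_add_right]
  | @insert e X he _ ih =>
    have hinsert : insert e X = X ∆ {e} := by
      rw [(Set.disjoint_singleton_right.2 he).symmDiff_eq_sup]
      exact Set.union_singleton.symm
    calc φ (A ∆ insert e X) = φ ((A ∆ X) ∆ {e}) := by rw [hinsert, symmDiff_assoc]
      _ ≤ φ (A ∆ X) + 1 := h.apply_symmDiff_singleton_le _ _
      _ ≤ φ A + X.ncard + 1 := Nat.add_le_add_right ih 1
      _ = φ A + (insert e X).ncard := by rw [Set.ncard_insert_of_notMem he, add_assoc]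

theorem exists_feasible_symmDiff [Finite E] (h : D.IsLevelFunction φ m) (A : Set E) :
    ∃ F ∈ D.feasible, ∃ X : Set E, m + X.ncard ≤ φ A ∧ A = F ∆ X := by
  induction hd : φ A using Nat.strong_induction_on generalizing A with
  | _ d ih =>
    subst hd
    rcases (h.le_apply A).eq_or_lt with hA | hA
    · exact ⟨A, (h.mem_feasible_iff A).2 hA.symm, ∅, by simp [hA], (symmDiff_bot A).symm⟩
    · obtain ⟨e, he⟩ := h.exists_apply_symmDiff_lt A hA
      obtain ⟨F, hF, X, hX, hFX⟩ := ih _ he _ rfl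
      refine ⟨F, hF, X ∆ {e}, ?_, ?_⟩
      · have hcard : (X ∆ {e}).ncard ≤ X.ncard + 1 :=
          (Set.ncard_le_ncard (symmDiff_le_sup (a := X) (b := {e})) (Set.toFinite _)).trans
            ((Set.ncard_union_le _ _).trans_eq (by rw [Set.ncard_singleton]))
        omega
      · rw [← symmDiff_assoc, ← hFX, symmDiff_symmDiff_cancel_right]

theorem mem_spread_iff [Finite E] (h : D.IsLevelFunction φ m) (n : ℕ) (A : Set E) :
    A ∈ (D.spread n).feasible ↔ φ A ≤ m + n := by
  constructor
  · rintro ⟨F, hF, X, hX, rfl⟩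
    have hle := h.apply_symmDiff_le F X
    rw [(h.mem_feasible_iff F).1 hF] at hle
    omega
  · intro hA
    obtain ⟨F, hF, X, hX, hFX⟩ := h.exists_feasible_symmDiff A
    exact ⟨F, hF, X, by omega, hFX⟩

theorem mem_toggle_iff [Finite E] (h : D.IsLevelFunction φ m) (n : ℕ) (A : Set E) :
    A ∈ (D.toggle n).feasible ↔ φ A = m + n := by
  change A ∈ (D.spread n).feasible ∧ A ∉ (D.spread (n - 1)).feasible ↔ _
  rw [h.mem_spread_iff]
  cases n with
  | zero =>
    have hempty : A ∉ (D.spread ((0 : ℕ) - 1)).feasible := by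
      rintro ⟨F, -, X, hX, -⟩
      omega
    have := h.le_apply A
    simp only [hempty, not_false_eq_true, and_true]
    omega
  | succ n =>
    rw [Nat.cast_succ, add_sub_cancel_right, h.mem_spread_iff]
    omega

theorem exists_apply_eq (h : D.IsLevelFunction φ m) {j : ℕ} (hj : m ≤ j) {A : Set E}
    (hA : j ≤ φ A) : ∃ B, φ B = j := by
  induction hd : φ A using Nat.strong_induction_on generalizing A with
  | _ d ih =>
    subst hd
    rcases hA.eq_or_lt with rfl | hlt
    · exact ⟨A, rfl⟩
    · obtain ⟨e, he⟩ := h.exists_apply_symmDiff_lt A (hj.trans_lt hlt)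
      have hstep := h.apply_symmDiff_singleton_le (A ∆ {e}) e
      rw [symmDiff_symmDiff_cancel_right] at hstep
      exact ih _ he (by omega) rfl

theorem toggle_feasible_nonempty [Finite E] (h : D.IsLevelFunction φ m) {n : ℕ} {A : Set E}
    (hA : m + n ≤ φ A) : (D.toggle n).feasible.Nonempty := by
  obtain ⟨B, hB⟩ := h.exists_apply_eq (Nat.le_add_right m n) hA
  exact ⟨B, (h.mem_toggle_iff n B).2 hB⟩

end IsLevelFunction

end SetSystem

namespace RibbonGraph

variable {V E : Type*} {G : RibbonGraph V E}

theorem vert_rot (G : RibbonGraph V E) (h : E × Bool) : G.vert (G.rot h) = G.vert h :=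
  (G.vert_eq_iff _ _).2 (Equiv.Perm.sameCycle_apply_left.2 .rfl)

namespace Subgraph

/-- The closed boundary curves of a ribbon subgraph through corners; the boundary circles of
isolated vertices of `G` carry no corner and are not among them. -/
def BoundaryCurve (H : G.Subgraph) : Type _ :=
  Quot fun c d : H.Corner => H.BoundaryStep c.1 d.1

/-- The boundary components of a ribbon subgraph. -/
def Boundary (H : G.Subgraph) : Type _ :=
  H.BoundaryCurve ⊕ {v : V // v ∈ H.verts ∧ ∀ h, G.vert h ≠ v}

instance [Finite E] (H : G.Subgraph) : Finite H.Corner := inferInstanceAs (Finite (Subtype _))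

instance [Finite E] (H : G.Subgraph) : Finite H.BoundaryCurve := inferInstanceAs (Finite (Quot _))

instance [Finite V] [Finite E] (H : G.Subgraph) : Finite H.Boundary :=
  inferInstanceAs (Finite (_ ⊕ _))

instance [Finite V] (H : G.Subgraph) : Finite H.Component := inferInstanceAs (Finite (Quot _))

theorem card_boundary [Finite V] [Finite E] (H : G.Subgraph) : Nat.card H.Boundary = H.f :=
  Nat.card_sum

/-- The connected component on which a boundary component lies. -/
def Boundary.toComponent {H : G.Subgraph} : H.Boundary → H.Component :=
  Sum.elim
    (Quot.lift (fun c => Quot.mk _ ⟨G.vert c.1.1, c.2⟩) (by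
      rintro ⟨c, hc⟩ ⟨d, hd⟩ (h : H.BoundaryStep c d)
      cases h with
      | arc h => exact congrArg (Quot.mk _) (Subtype.ext (G.vert_rot h).symm)
      | segment h he => rfl
      | side e i s he => exact Quot.sound ⟨e, he, i, rfl, rfl⟩))
    fun v => Quot.mk _ ⟨v.1, v.2.1⟩

theorem Boundary.toComponent_surjective (H : G.Subgraph) :
    Function.Surjective (Boundary.toComponent (H := H)) := by
  rintro ⟨v, hv⟩
  by_cases h : ∃ h, G.vert h = v
  · obtain ⟨h, rfl⟩ := h
    exact ⟨.inl (Quot.mk _ ⟨(h, false), hv⟩), rfl⟩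
  · exact ⟨.inr ⟨v, hv, not_exists.1 h⟩, rfl⟩

theorem k_le_f [Finite V] [Finite E] (H : G.Subgraph) : H.k ≤ H.f :=
  H.card_boundary ▸ Nat.card_le_card_of_surjective _ (Boundary.toComponent_surjective H)

/-- `H'` is a union of connected components of `H`: some of the vertices of `H`, together with
all edges of `H` that meet them. -/
structure IsUnionOfComponents (H' H : G.Subgraph) : Prop where
  verts_subset : H'.verts ⊆ H.verts
  mem_edges_iff : ∀ h : E × Bool, G.vert h ∈ H'.verts → (h.1 ∈ H'.edges ↔ h.1 ∈ H.edges)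

namespace IsUnionOfComponents

variable {H' H : G.Subgraph}

theorem boundaryStep_iff (hH : H'.IsUnionOfComponents H) {c d : (E × Bool) × Bool}
    (hc : G.vert c.1 ∈ H'.verts) : H'.BoundaryStep c d ↔ H.BoundaryStep c d := by
  constructor
  · intro h
    cases h with
    | arc h => exact .arc h
    | segment h he => exact .segment h (mt (hH.mem_edges_iff h hc).2 he)
    | side e i s he => exact .side e i s ((hH.mem_edges_iff (e, i) hc).1 he)
  · intro h
    cases h with
    | arc h => exact .arc h
    | segment h he => exact .segment h (mt (hH.mem_edges_iff h hc).1 he)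
    | side e i s he => exact .side e i s ((hH.mem_edges_iff (e, i) hc).2 he)

theorem vert_mem_iff (hH : H'.IsUnionOfComponents H) {c d : (E × Bool) × Bool}
    (h : H.BoundaryStep c d) : G.vert c.1 ∈ H'.verts ↔ G.vert d.1 ∈ H'.verts := by
  cases h with
  | arc h => rw [G.vert_rot]
  | segment h he => rfl
  | side e i s he =>
    exact ⟨fun hv => H'.vert_mem e ((hH.mem_edges_iff (e, i) hv).2 he) _,
      fun hv => H'.vert_mem e ((hH.mem_edges_iff (e, !i) hv).2 he) _⟩

/-- A boundary component of a union of components of `H`, as a boundary component of `H`. -/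
def boundaryMap (hH : H'.IsUnionOfComponents H) : H'.Boundary → H.Boundary :=
  Sum.map
    (Quot.map (fun c => ⟨c.1, hH.verts_subset c.2⟩) fun c _ => (hH.boundaryStep_iff c.2).1)
    fun v => ⟨v.1, hH.verts_subset v.2.1, v.2.2⟩

theorem boundaryMap_injective (hH : H'.IsUnionOfComponents H) :
    Function.Injective hH.boundaryMap := by
  let incl : H'.Corner → H.Corner := fun c => ⟨c.1, hH.verts_subset c.2⟩
  have mem_range_incl : ∀ c : H.Corner, c ∈ Set.range incl ↔ G.vert c.1.1 ∈ H'.verts := fun c =>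
    ⟨by rintro ⟨c, rfl⟩; exact c.2, fun hc => ⟨⟨c.1, hc⟩, rfl⟩⟩
  refine Sum.map_injective.2 ⟨?_, fun v w h => Subtype.ext (Subtype.ext_iff.1 h :)⟩
  refine injective_quot_map (f := incl) (fun c d h => Subtype.ext (Subtype.ext_iff.1 h :))
    (fun c _ => hH.boundaryStep_iff c.2) fun c d h => ?_
  rw [mem_range_incl, mem_range_incl, hH.vert_mem_iff h]

theorem f_le_f [Finite V] [Finite E] (hH : H'.IsUnionOfComponents H) : H'.f ≤ H.f := by
  rw [← card_boundary, ← card_boundary]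
  exact Nat.card_le_card_of_injective _ hH.boundaryMap_injective

end IsUnionOfComponents

theorem isUnionOfComponents_spanning (H : G.Subgraph) :
    H.IsUnionOfComponents (G.spanning H.edges) where
  verts_subset := Set.subset_univ _
  mem_edges_iff := fun _ _ => Iff.rfl

theorem isUnionOfComponents_component (H : G.Subgraph) (C : H.Component) :
    (H.component C).IsUnionOfComponents H where
  verts_subset := fun _ hv => hv.1
  mem_edges_iff := by
    rintro ⟨e, i⟩ ⟨hv, hC⟩
    refine ⟨fun h => h.1, fun he => ⟨he, ?_⟩⟩
    cases i
    · exact hC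
    · exact (Quot.sound ⟨e, he, false, rfl, rfl⟩ : (Quot.mk _ _ : H.Component) = _).trans hC

theorem toComponent_boundaryMap (H : G.Subgraph) (C : H.Component)
    (b : (H.component C).Boundary) :
    ((H.isUnionOfComponents_component C).boundaryMap b).toComponent = C := by
  rcases b with ⟨⟨_, hc⟩⟩ | ⟨v, hv, -⟩
  · exact hc.2
  · exact hv.2

theorem f_eq_sum_component [Finite V] [Finite E] (H : G.Subgraph) [Fintype H.Component] :
    H.f = ∑ C, (H.component C).f := by
  let φ : (Σ C, (H.component C).Boundary) → H.Boundary := fun x =>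
    (H.isUnionOfComponents_component x.1).boundaryMap x.2
  have hφ : Function.Bijective φ := by
    constructor
    · rintro ⟨C, b⟩ ⟨C', b'⟩ h
      obtain rfl : C = C' := by
        rw [← H.toComponent_boundaryMap C b, ← H.toComponent_boundaryMap C' b']
        exact congrArg _ h
      exact congrArg _ ((H.isUnionOfComponents_component C).boundaryMap_injective h)
    · rintro (⟨⟨c, hc⟩⟩ | ⟨v, hv, hiso⟩)
      · exact ⟨⟨Quot.mk _ ⟨_, hc⟩, .inl (Quot.mk _ ⟨c, hc, rfl⟩)⟩, rfl⟩
      · exact ⟨⟨Quot.mk _ ⟨v, hv⟩, .inr ⟨v, ⟨hv, rfl⟩, hiso⟩⟩, rfl⟩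
  simp only [← card_boundary, ← Nat.card_sigma, Nat.card_congr (Equiv.ofBijective φ hφ)]

theorem component_verts_nonempty (H : G.Subgraph) (C : H.Component) :
    (H.component C).verts.Nonempty := by
  obtain ⟨⟨v, hv⟩⟩ := C
  exact ⟨v, hv, rfl⟩

theorem one_le_f [Finite V] [Finite E] {H : G.Subgraph} (hH : H.verts.Nonempty) : 1 ≤ H.f := by
  obtain ⟨v, hv⟩ := hH
  have : Nonempty H.Component := ⟨Quot.mk _ ⟨v, hv⟩⟩
  exact (Nat.succ_le_of_lt Nat.card_pos).trans H.k_le_f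

theorem f_eq_k_iff [Finite V] [Finite E] (H : G.Subgraph) :
    H.f = H.k ↔ ∀ C, (H.component C).f = 1 := by
  have := Fintype.ofFinite H.Component
  have hk : H.k = ∑ _C : H.Component, 1 := by
    rw [Finset.sum_const, smul_eq_mul, mul_one, Finset.card_univ, k, Nat.card_eq_fintype_card]
  rw [H.f_eq_sum_component, hk, eq_comm,
    Finset.sum_eq_sum_iff_of_le fun C _ => one_le_f (H.component_verts_nonempty C)]
  simp only [Finset.mem_univ, true_imp_iff, eq_comm]

end Subgraph

theorem k_le_k_spanning [Finite V] (G : RibbonGraph V E) (A : Set E) :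
    G.k ≤ (G.spanning A).k := by
  let φ : (G.spanning A).Component → (G.spanning Set.univ).Component :=
    Quot.map id fun _ _ ⟨e, _, h⟩ => ⟨e, Set.mem_univ e, h⟩
  refine Nat.card_le_card_of_surjective φ ?_
  rintro ⟨v⟩
  exact ⟨Quot.mk _ v, rfl⟩

theorem k_le_f_spanning [Finite V] [Finite E] (G : RibbonGraph V E) (A : Set E) :
    G.k ≤ (G.spanning A).f :=
  (G.k_le_k_spanning A).trans (Subgraph.k_le_f _)

theorem isSpanningQuasiTree_iff [Finite V] [Finite E] (G : RibbonGraph V E) (A : Set E) :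
    G.IsSpanningQuasiTree A ↔ (G.spanning A).f = G.k := by
  rw [IsSpanningQuasiTree, ← Subgraph.f_eq_k_iff]
  have h1 := G.k_le_k_spanning A
  have h2 := (G.spanning A).k_le_f
  omega

/-- The other end of the arc of a vertex disc that starts or ends at a corner. -/
def arcPartner (G : RibbonGraph V E) : (E × Bool) × Bool → (E × Bool) × Bool
  | (h, true) => (G.rot h, false)
  | (h, false) => (G.rot.symm h, true)

open Classical in
/-- The other end of the piece of the boundary of `(V, A)` at a corner that is not an arc of a
vertex disc: a side of an edge in `A`, or a segment of an edge outside `A`. -/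
noncomputable def edgePartner (G : RibbonGraph V E) (A : Set E) (c : (E × Bool) × Bool) :
    (E × Bool) × Bool :=
  if c.1.1 ∈ A then ((c.1.1, !c.1.2), if G.twisted c.1.1 then c.2 else !c.2) else (c.1, !c.2)

theorem arcPartner_involutive (G : RibbonGraph V E) : Function.Involutive G.arcPartner := by
  rintro ⟨h, _ | _⟩ <;> simp [arcPartner]

theorem arcPartner_ne (G : RibbonGraph V E) (c : (E × Bool) × Bool) : G.arcPartner c ≠ c := by
  rcases c with ⟨h, _ | _⟩ <;> simp [arcPartner]

theorem edgePartner_of_mem {A : Set E} {e : E} (he : e ∈ A) (i s : Bool) :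
    G.edgePartner A ((e, i), s) = ((e, !i), if G.twisted e then s else !s) := if_pos he

theorem edgePartner_of_notMem {A : Set E} {h : E × Bool} (he : h.1 ∉ A) (s : Bool) :
    G.edgePartner A (h, s) = (h, !s) := if_neg he

theorem edgePartner_fst_fst (G : RibbonGraph V E) (A : Set E) (c : (E × Bool) × Bool) :
    (G.edgePartner A c).1.1 = c.1.1 := by
  rw [edgePartner]
  split_ifs <;> rfl

theorem edgePartner_involutive (G : RibbonGraph V E) (A : Set E) :
    Function.Involutive (G.edgePartner A) := by
  rintro ⟨⟨e, i⟩, s⟩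
  by_cases he : e ∈ A
  · cases ht : G.twisted e <;> simp [edgePartner_of_mem he, ht]
  · simp [edgePartner_of_notMem (h := (e, i)) he]

theorem edgePartner_ne (G : RibbonGraph V E) (A : Set E) (c : (E × Bool) × Bool) :
    G.edgePartner A c ≠ c := by
  rcases c with ⟨⟨e, i⟩, s⟩
  by_cases he : e ∈ A
  · simp [edgePartner_of_mem he]
  · simp [edgePartner_of_notMem (h := (e, i)) he]

theorem edgePartner_congr {A B : Set E} {c : (E × Bool) × Bool} (h : c.1.1 ∈ A ↔ c.1.1 ∈ B) :
    G.edgePartner A c = G.edgePartner B c := by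
  by_cases hA : c.1.1 ∈ A
  · rw [edgePartner, edgePartner, if_pos hA, if_pos (h.1 hA)]
  · rw [edgePartner, edgePartner, if_neg hA, if_neg (mt h.2 hA)]

/-- The closed boundary curve of `(V, A)` through a corner. As `(V, A)` has all corners of `G`,
it is encoded without the subtype used in `Subgraph.BoundaryCurve`. -/
def curve (G : RibbonGraph V E) (A : Set E) (c : (E × Bool) × Bool) :
    Quot (G.spanning A).BoundaryStep :=
  Quot.mk _ c

theorem eq_arcPartner_or_eq_edgePartner {A : Set E} {c d : (E × Bool) × Bool}
    (h : (G.spanning A).BoundaryStep c d) : d = G.arcPartner c ∨ d = G.edgePartner A c := by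
  cases h with
  | arc h => exact .inl rfl
  | segment h he => exact .inr (edgePartner_of_notMem he false).symm
  | side e i s he => exact .inr (edgePartner_of_mem he i s).symm

theorem curve_arcPartner (A : Set E) (c : (E × Bool) × Bool) :
    G.curve A (G.arcPartner c) = G.curve A c := by
  have curve_rot : ∀ h, G.curve A (h, true) = G.curve A (G.rot h, false) := fun h =>
    Quot.sound (.arc h)
  rcases c with ⟨h, _ | _⟩
  · simpa only [arcPartner, Equiv.apply_symm_apply] using curve_rot (G.rot.symm h)
  · exact (curve_rot h).symm

theorem curve_edgePartner (A : Set E) (c : (E × Bool) × Bool) :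
    G.curve A (G.edgePartner A c) = G.curve A c := by
  rcases c with ⟨⟨e, i⟩, s⟩
  by_cases he : e ∈ A
  · rw [edgePartner_of_mem he]
    exact (Quot.sound (.side e i s he)).symm
  · have curve_segment : G.curve A ((e, i), false) = G.curve A ((e, i), true) :=
      Quot.sound (.segment (e, i) he)
    rw [edgePartner_of_notMem he]
    cases s
    exacts [curve_segment.symm, curve_segment]

theorem f_spanning (G : RibbonGraph V E) (A : Set E) :
    (G.spanning A).f = Nat.card (Quot (G.spanning A).BoundaryStep) +
      Nat.card {v : V // ∀ h, G.vert h ≠ v} := by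
  refine congrArg₂ (· + ·) (Nat.card_congr ?_) (Nat.card_congr ?_)
  · exact Quot.congr (Equiv.subtypeUnivEquiv fun _ => Set.mem_univ _) fun _ _ => Iff.rfl
  · exact Equiv.subtypeEquivRight fun v => and_iff_right (Set.mem_univ v)

section ToggleEdge

variable {A B : Set E} {e : E}

theorem mem_iff_notMem_of_symmDiff_eq (hAB : A ∆ B = {e}) : e ∈ A ↔ e ∉ B := by
  have he : e ∈ A ∆ B := hAB ▸ Set.mem_singleton e
  rw [Set.mem_symmDiff] at he
  tauto

theorem edgePartner_eq_of_symmDiff_eq (hAB : A ∆ B = {e}) {c : (E × Bool) × Bool}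
    (hc : c.1.1 ≠ e) : G.edgePartner A c = G.edgePartner B c := by
  have hmem : c.1.1 ∉ A ∆ B := hAB ▸ hc
  rw [Set.mem_symmDiff] at hmem
  exact edgePartner_congr (by tauto)

/-- On the corners `(i, s)` of `e`, the two pairings are translations by distinct nonzero elements
of Klein's group `(ℤ/2)²`. -/
theorem eq_or_eq_edgePartner (hAB : A ∆ B = {e}) {a c : (E × Bool) × Bool} (ha : a.1.1 = e)
    (hc : c.1.1 = e) :
    c = a ∨ c = G.edgePartner A a ∨ c = G.edgePartner B a ∨
      c = G.edgePartner A (G.edgePartner B a) := by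
  have heAB := mem_iff_notMem_of_symmDiff_eq hAB
  rcases a with ⟨⟨e, i⟩, s⟩
  rcases c with ⟨⟨e', j⟩, t⟩
  obtain rfl : e = _ := ha
  obtain rfl : e' = e := hc
  by_cases hB : e' ∈ B <;> cases ht : G.twisted e' <;>
    cases i <;> cases s <;> cases j <;> cases t <;>
    simp [edgePartner, heAB, hB, ht]

theorem curve_eq_or_eq (hAB : A ∆ B = {e}) {a c : (E × Bool) × Bool} (ha : a.1.1 = e)
    (hc : c.1.1 = e) :
    G.curve A c = G.curve A a ∨ G.curve A c = G.curve A (G.edgePartner B a) := by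
  rcases eq_or_eq_edgePartner (G := G) hAB ha hc with rfl | rfl | rfl | rfl <;>
    simp only [curve_edgePartner, true_or, or_true]

theorem curve_eq_curve_of_boundaryStep (hAB : A ∆ B = {e}) {c d : (E × Bool) × Bool}
    (h : (G.spanning B).BoundaryStep c d) :
    G.curve A c = G.curve A d ∨ c.1.1 = e ∧ d.1.1 = e := by
  rcases eq_arcPartner_or_eq_edgePartner h with rfl | rfl
  · exact .inl (curve_arcPartner A c).symm
  · by_cases hc : c.1.1 = e
    · exact .inr ⟨hc, (G.edgePartner_fst_fst B c).trans hc⟩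
    · rw [← edgePartner_eq_of_symmDiff_eq hAB hc, curve_edgePartner]
      exact .inl rfl

theorem f_spanning_le_add_one [Finite E] (hAB : A ∆ B = {e}) :
    (G.spanning A).f ≤ (G.spanning B).f + 1 := by
  let a : (E × Bool) × Bool := ((e, false), false)
  rw [f_spanning, f_spanning, add_right_comm]
  refine Nat.add_le_add_right
    (card_quot_le_card_quot_add_one a (G.edgePartner B a) fun c d h => ?_) _
  exact (curve_eq_curve_of_boundaryStep hAB h).imp_right fun ⟨hc, hd⟩ =>
    ⟨curve_eq_or_eq hAB rfl hc, curve_eq_or_eq hAB rfl hd⟩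

/-- The corners on both the `A`-curve and the `B`-curve through `a` are closed under arcs and,
except possibly at `a`, under the pieces of `(V, A)`; counting them mod 2 closes the gap at `a`. -/
theorem curve_edgePartner_eq_of_ne [Finite E] (hAB : A ∆ B = {e}) {a : (E × Bool) × Bool}
    (ha : a.1.1 = e) (hne : G.curve A a ≠ G.curve A (G.edgePartner B a)) :
    G.curve B (G.edgePartner A a) = G.curve B a := by
  let s : Set ((E × Bool) × Bool) := {c | G.curve A c = G.curve A a ∧ G.curve B c = G.curve B a}
  suffices h : G.edgePartner A a ∈ s from h.2
  refine apply_mem_of_involutive s.toFinite G.arcPartner_involutive G.arcPartner_ne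
    (G.edgePartner_involutive A) (G.edgePartner_ne A) ⟨rfl, rfl⟩ (fun c hc => ?_)
    fun c ⟨hcA, hcB⟩ hca => ⟨(curve_edgePartner A c).trans hcA, ?_⟩
  · simpa only [s, Set.mem_ofPred_eq, curve_arcPartner] using hc
  · by_cases hce : c.1.1 = e
    · rcases eq_or_eq_edgePartner (G := G) hAB ha hce with rfl | rfl | rfl | rfl
      · exact absurd rfl hca
      · rw [G.edgePartner_involutive A]
      · exact absurd hcA.symm hne
      · exact absurd (hcA.symm.trans (curve_edgePartner A _)) hne
    · rw [edgePartner_eq_of_symmDiff_eq hAB hce, curve_edgePartner, hcB]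

theorem f_spanning_lt_of_curve_ne [Finite E] (hAB : A ∆ B = {e}) {a : (E × Bool) × Bool}
    (ha : a.1.1 = e) (hne : G.curve A a ≠ G.curve A (G.edgePartner B a)) :
    (G.spanning B).f < (G.spanning A).f := by
  have hBA : B ∆ A = {e} := symmDiff_comm A B ▸ hAB
  have curve_eq : ∀ c : (E × Bool) × Bool, c.1.1 = e → G.curve B c = G.curve B a := fun c hc =>
    (curve_eq_or_eq hBA ha hc).elim id fun h =>
      h.trans (curve_edgePartner_eq_of_ne hAB ha hne)
  rw [f_spanning, f_spanning]
  refine Nat.add_lt_add_right (card_quot_lt_card_quot (fun c d h => ?_) hne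
    (curve_edgePartner B a).symm) _
  exact (curve_eq_curve_of_boundaryStep hBA h).elim id fun ⟨hc, hd⟩ =>
    (curve_eq c hc).trans (curve_eq d hd).symm

theorem curve_eq_of_f_spanning_le [Finite E] (hAB : A ∆ B = {e})
    (hf : (G.spanning A).f ≤ (G.spanning B).f) {a c : (E × Bool) × Bool} (ha : a.1.1 = e)
    (hc : c.1.1 = e) : G.curve A c = G.curve A a := by
  have hpartner : G.curve A a = G.curve A (G.edgePartner B a) := by
    by_contra hne
    exact hf.not_gt (f_spanning_lt_of_curve_ne hAB ha hne)
  exact (curve_eq_or_eq hAB ha hc).elim id fun h => h.trans hpartner.symm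

end ToggleEdge

section LocalMinimum

variable {A : Set E}

theorem curve_eq_of_vert_eq
    (hA : ∀ c d : (E × Bool) × Bool, c.1.1 = d.1.1 → G.curve A c = G.curve A d)
    {c d : (E × Bool) × Bool} (hv : G.vert c.1 = G.vert d.1) : G.curve A c = G.curve A d := by
  have curve_rot : ∀ h, G.curve A (G.rot h, false) = G.curve A (h, false) := fun h =>
    (curve_arcPartner A (h, true)).trans (hA _ _ rfl)
  calc G.curve A c = G.curve A (c.1, false) := hA _ _ rfl
    _ = G.curve A (d.1, false) :=
      apply_eq_of_sameCycle (φ := fun h => G.curve A (h, false)) curve_rot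
        ((G.vert_eq_iff _ _).1 hv)
    _ = G.curve A d := hA _ _ rfl

theorem f_spanning_le_k_of_curve_eq [Finite V] [Finite E]
    (hA : ∀ c d : (E × Bool) × Bool, c.1.1 = d.1.1 → G.curve A c = G.curve A d) :
    (G.spanning A).f ≤ G.k := by
  let β := Quot (G.spanning A).BoundaryStep ⊕ {v : V // ∀ h, G.vert h ≠ v}
  have exists_boundary : ∀ v : V, ∃ b : β,
      (∀ c, G.vert c.1 = v → b = .inl (G.curve A c)) ∧ ∀ hv, b = .inr ⟨v, hv⟩ := by
    intro v
    by_cases hv : ∃ h, G.vert h = v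
    · obtain ⟨h, rfl⟩ := hv
      exact ⟨.inl (G.curve A (h, false)),
        fun c hc => congrArg Sum.inl (curve_eq_of_vert_eq hA hc.symm),
        fun hv => absurd rfl (hv h)⟩
    · exact ⟨.inr ⟨v, not_exists.1 hv⟩, fun c hc => absurd ⟨c.1, hc⟩ hv, fun _ => rfl⟩
  choose boundaryAt boundaryAt_vert boundaryAt_isolated using exists_boundary
  let φ : (G.spanning Set.univ).Component → β := Quot.lift (fun v => boundaryAt v.1) (by
    rintro ⟨_, _⟩ ⟨_, _⟩ ⟨e, -, i, rfl, rfl⟩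
    rw [boundaryAt_vert _ ((e, i), false) rfl, boundaryAt_vert _ ((e, !i), false) rfl,
      hA ((e, i), false) ((e, !i), false) rfl])
  have hφ : Function.Surjective φ := by
    rintro (q | ⟨v, hv⟩)
    · obtain ⟨c, rfl⟩ := Quot.exists_rep q
      exact ⟨Quot.mk _ ⟨G.vert c.1, Set.mem_univ _⟩, boundaryAt_vert _ c rfl⟩
    · exact ⟨Quot.mk _ ⟨v, Set.mem_univ _⟩, boundaryAt_isolated v hv⟩
  rw [f_spanning, ← Nat.card_sum]
  exact Nat.card_le_card_of_surjective φ hφ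

theorem exists_f_spanning_symmDiff_lt [Finite V] [Finite E] (hA : G.k < (G.spanning A).f) :
    ∃ e, (G.spanning (A ∆ {e})).f < (G.spanning A).f := by
  by_contra! hmin
  refine hA.not_ge (f_spanning_le_k_of_curve_eq fun c d hcd => ?_)
  exact curve_eq_of_f_spanning_le (symmDiff_symmDiff_cancel_left A {d.1.1}) (hmin _) rfl hcd

end LocalMinimum

theorem isLevelFunction_f_spanning [Finite V] [Finite E] (G : RibbonGraph V E) :
    G.D.IsLevelFunction (fun A => (G.spanning A).f) G.k where
  mem_feasible_iff := G.isSpanningQuasiTree_iff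
  le_apply := G.k_le_f_spanning
  apply_symmDiff_singleton_le A e := f_spanning_le_add_one (e := e) (by
    rw [symmDiff_comm, symmDiff_symmDiff_cancel_left])
  exists_apply_symmDiff_lt _ := exists_f_spanning_symmDiff_lt

end RibbonGraph

theorem mainTheorem5 {V E : Type*} [Finite V] [Finite E] (G : RibbonGraph V E) (n : ℕ) :
    G.DLe n = G.D.spread n ∧
    ((∃ H : G.Subgraph, H.f = n + G.k) →
      (G.D.toggle n).feasible.Nonempty ∧ G.DEq n = G.D.toggle n) := by
  have hf := G.isLevelFunction_f_spanning
  refine ⟨SetSystem.ext (Set.ext fun A => (hf.mem_spread_iff n A).symm), ?_⟩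
  rintro ⟨H, hH⟩
  have hle : G.k + n ≤ (G.spanning H.edges).f := by
    rw [add_comm, ← hH]
    exact H.isUnionOfComponents_spanning.f_le_f
  exact ⟨hf.toggle_feasible_nonempty hle,
    SetSystem.ext (Set.ext fun A => (hf.mem_toggle_iff n A).symm)⟩
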